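/- Let $\mathcal A$ be a small 2-category and let $W\colon\mathcal A\to\mathbf{Cat}$, $F\colon\mathcal A\to\mathcal C$ and $G\colon\mathcal C\to\mathcal D$ be (strict) 2-functors. The \emph{2-category of elements} $\int W$ has as objects the pairs $(A,X)$ with $A\in\mathcal A$, $X\in W(A)$; as morphisms $(A,X)\to(B,Y)$ the pairs $(f,\alpha)$ with $f\colon A\to B$ in $\mathcal A$ and $\alpha\colon W(f)(X)\to Y$ in $W(B)$; and as 2-cells $(f,\alpha)\Rightarrow(g,\beta)$ the 2-cells $\delta\colon f\Rightarrow g$ of $\mathcal A$ with $\alpha=\beta\circ W(\delta)_X$. Let $\pi\colon\int W\to\mathcal A$ be the projection. For a 2-functor $K\colon\int W\to\mathcal C$, a \emph{cartesian-marked lax cone} on $K$ with vertex $L\in\mathcal C$ is a lax natural transformation $\Delta 1\Rightarrow\mathcal C(L,K(-))$ whose structure 2-cell at every morphism of the form $(f,\mathrm{id})$ is an identity; with modifications between them these cones form a category $\mathrm{Cone}_K(L)$. Such a cone is a \emph{cartesian-marked lax conical limit} of $K$ if there is an isomorphism of categories $\mathcal C(U,L)\cong\mathrm{Cone}_K(U)$,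 2-natural in $U\in\mathcal C^{\mathrm{op}}$, that sends $\mathrm{id}_L$ to it. A \emph{$W$-cylinder} on $F$ with vertex $L$ is a 2-natural transformation $\lambda\colon W\Rightarrow\mathcal C(L,F(-))$; it is a \emph{$W$-weighted 2-limit} of $F$ if there is an isomorphism of categories $\mathcal C(U,L)\cong[\mathcal A,\mathbf{Cat}](W,\mathcal C(U,F(-)))$, 2-natural in $U\in\mathcal C^{\mathrm{op}}$, that sends $\mathrm{id}_L$ to $\lambda$. The cartesian-marked lax cone \emph{associated} with a $W$-cylinder $\lambda$ on $F$ is the cone $\widehat\lambda$ on $F\circ\pi$ with the same vertex given by $$\widehat\lambda_{(A,X)}=\lambda_A(X),\qquad \widehat\lambda_{(f,\alpha)}=\lambda_B(\alpha)\quad\text{for }(f,\alpha)\colon(A,X)\to(B,Y).$$ Applying $G$ sends a $W$-cylinder $\lambda$ on $F$ to a $W$-cylinder $G\lambda$ on $G\circ F$, and a cartesian-marked lax cone on $F\circ\pi$ to one on $G\circ F\circ\pi$. Then: 1. A $W$-cylinder $\lambda$ on $F$ is a $W$-weighted 2-limit of $F$ if and only if $\widehat\lambda$ is a cartesian-marked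 lax conical limit of $F\circ\pi$. 2. $G$ preserves a given $W$-weighted 2-limit of $F$ if and only if it preserves the associated cartesian-marked lax conical limit: for every $W$-weighted 2-limit $\lambda$ of $F$, $G\lambda$ is a $W$-weighted 2-limit of $G\circ F$ if and only if $G\widehat\lambda$ is a cartesian-marked lax conical limit of $G\circ F\circ\pi$. 3. $G$ reflects a given $W$-weighted 2-limit if and only if it reflects the associated cartesian-marked lax conical limit: for every $W$-cylinder $\lambda$ on $F$, the implication "if $G\lambda$ is a $W$-weighted 2-limit of $G\circ F$, then $\lambda$ is one of $F$" holds if and only if the implication "if $G\widehat\lambda$ is a cartesian-marked lax conical limit of $G\circ F\circ\pi$, then $\widehat\lambda$ is one of $F\circ\pi$" holds. 4. $G$ preserves (respectively reflects) all $W$-weighted 2-limits of $F$ if and only if it preserves (respectively reflects) all cartesian-marked lax conical limits of $F\circ\pi$. -/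

import Mathlib

open CategoryTheory Bicategory
open scoped Lax.LaxTrans Lax.LaxTrans.LaxFunctor

universe w v w₁ v₁ u₁ w₂ v₂ u₂ u₃ u₄

namespace TwoLim

section Elements

variable {A : Type u₁} [Bicategory.{w₁, v₁} A]

/-- Objects of the 2-category of elements of `W : A → Cat`: pairs `(a, X)` with `X ∈ W a`. -/
@[ext]
structure El (W : StrictPseudofunctor A Cat.{w, v}) where
  base : A
  fiber : W.obj base

namespace El

variable {W : StrictPseudofunctor A Cat.{w, v}}

/-- Morphisms `(a, X) ⟶ (b, Y)`: pairs `(f, α)` with `f : a ⟶ b` and `α : W f X ⟶ Y`. -/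
structure Hom (x y : El W) where
  base : x.base ⟶ y.base
  fiber : (W.map base).toFunctor.obj x.fiber ⟶ y.fiber

/-- 2-cells `(f, α) ⟶ (g, β)`: 2-cells `δ : f ⟶ g` of `A` with `α = β ∘ (W δ)_X`. -/
@[ext]
structure Hom₂ {x y : El W} (p q : Hom x y) where
  base : p.base ⟶ q.base
  w : p.fiber = (W.map₂ base).toNatTrans.app x.fiber ≫ q.fiber

/-- The composite of `(f, α)` and `(g, β)` is `(g ∘ f, β ∘ W g α)`; the component of the
(identity) comparison `W (g ∘ f) = W g ∘ W f` only serves to make this well typed. -/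
instance : CategoryStruct (El W) where
  Hom := Hom
  id x := ⟨𝟙 x.base, (W.mapId x.base).hom.toNatTrans.app x.fiber⟩
  comp {x _ _} p q := ⟨p.base ≫ q.base, (W.mapComp p.base q.base).hom.toNatTrans.app x.fiber ≫
    (W.map q.base).toFunctor.map p.fiber ≫ q.fiber⟩

instance (x y : El W) : Category (x ⟶ y) where
  Hom p q := Hom₂ p q
  id p := ⟨𝟙 p.base, by simp⟩
  comp δ δ' := ⟨δ.base ≫ δ'.base, by rw [δ.w, δ'.w]; simp⟩
  id_comp _ := Hom₂.ext (Category.id_comp _)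
  comp_id _ := Hom₂.ext (Category.comp_id _)
  assoc _ _ _ := Hom₂.ext (Category.assoc _ _ _)

@[simp] lemma id_base (x : El W) : Hom.base (𝟙 x) = 𝟙 x.base := rfl
@[simp] lemma id_fiber (x : El W) :
    Hom.fiber (𝟙 x) = (W.mapId x.base).hom.toNatTrans.app x.fiber := rfl
@[simp] lemma comp_base {x y z : El W} (p : x ⟶ y) (q : y ⟶ z) :
    (p ≫ q).base = p.base ≫ q.base := rfl
@[simp] lemma comp_fiber {x y z : El W} (p : x ⟶ y) (q : y ⟶ z) :
    (p ≫ q).fiber = (W.mapComp p.base q.base).hom.toNatTrans.app x.fiber ≫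
      (W.map q.base).toFunctor.map p.fiber ≫ q.fiber := rfl
@[simp] lemma id₂_base {x y : El W} (p : x ⟶ y) : Hom₂.base (𝟙 p) = 𝟙 p.base := rfl
@[simp] lemma comp₂_base {x y : El W} {p q r : x ⟶ y} (δ : p ⟶ q) (δ' : q ⟶ r) :
    (δ ≫ δ').base = δ.base ≫ δ'.base := rfl

@[ext] lemma hom₂_ext {x y : El W} {p q : x ⟶ y} {δ δ' : p ⟶ q} (h : δ.base = δ'.base) : δ = δ' :=
  Hom₂.ext h

/-- An invertible 2-cell of `A` compatible with the fibres is invertible in the elements. -/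
def isoMk {x y : El W} {p q : x ⟶ y} (e : p.base ≅ q.base)
    (h : p.fiber = (W.map₂ e.hom).toNatTrans.app x.fiber ≫ q.fiber) : p ≅ q where
  hom := ⟨e.hom, h⟩
  inv := ⟨e.inv, by
    rw [h, ← Category.assoc, ← Cat.Hom₂.comp_app, ← W.map₂_comp]; simp⟩
  hom_inv_id := by ext; exact e.hom_inv_id
  inv_hom_id := by ext; exact e.inv_hom_id

@[simp] lemma isoMk_hom_base {x y : El W} {p q : x ⟶ y} (e : p.base ≅ q.base)
    (h : p.fiber = (W.map₂ e.hom).toNatTrans.app x.fiber ≫ q.fiber) :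
    (isoMk e h).hom.base = e.hom := rfl
@[simp] lemma isoMk_inv_base {x y : El W} {p q : x ⟶ y} (e : p.base ≅ q.base)
    (h : p.fiber = (W.map₂ e.hom).toNatTrans.app x.fiber ≫ q.fiber) :
    (isoMk e h).inv.base = e.inv := rfl

/-- Whiskering of 2-cells of the elements on the left, given by whiskering in `A`. -/
def whiskerLeft {x y z : El W} (p : x ⟶ y) {q r : y ⟶ z} (δ : q ⟶ r) : p ≫ q ⟶ p ≫ r :=
  ⟨p.base ◁ δ.base, by
    simp only [comp_fiber, comp_base, δ.w, W.map₂_whisker_left]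
    simp⟩

/-- Whiskering of 2-cells of the elements on the right, given by whiskering in `A`. -/
def whiskerRight {x y z : El W} {p q : x ⟶ y} (δ : p ⟶ q) (r : y ⟶ z) : p ≫ r ⟶ q ≫ r :=
  ⟨δ.base ▷ r.base, by
    simp only [comp_fiber, comp_base, δ.w, W.map₂_whisker_right]
    simp⟩

/-- The 2-category of elements; all compositions and whiskerings of 2-cells are those of `A`. -/
instance : Bicategory (El W) where
  homCategory := inferInstance
  whiskerLeft := whiskerLeft
  whiskerRight := whiskerRight
  associator {x y z t} p q r := isoMk (α_ p.base q.base r.base) (by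
    simp only [comp_fiber, comp_base, W.map₂_associator]
    simp)
  leftUnitor {x y} p := isoMk (λ_ p.base) (by
    simp only [comp_fiber, comp_base, id_base, id_fiber, W.map₂_left_unitor]
    simp)
  rightUnitor {x y} p := isoMk (ρ_ p.base) (by
    simp only [comp_fiber, comp_base, id_base, id_fiber, W.map₂_right_unitor]
    simp)
  id_whiskerLeft _ := by ext; exact Bicategory.id_whiskerLeft _
  comp_whiskerLeft _ _ _ _ _ := by ext; exact Bicategory.comp_whiskerLeft _ _ _
  whiskerRight_id _ := by ext; exact Bicategory.whiskerRight_id _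
  whiskerRight_comp _ _ _ := by ext; exact Bicategory.whiskerRight_comp _ _ _
  whisker_assoc _ _ _ _ _ := by ext; exact Bicategory.whisker_assoc _ _ _
  whisker_exchange _ _ := by ext; exact whisker_exchange _ _
  whiskerLeft_id _ _ := by ext; exact Bicategory.whiskerLeft_id _ _
  whiskerLeft_comp _ _ _ _ _ _ := by ext; exact Bicategory.whiskerLeft_comp _ _ _
  id_whiskerRight _ _ := by ext; exact Bicategory.id_whiskerRight _ _
  comp_whiskerRight _ _ _ := by ext; exact Bicategory.comp_whiskerRight _ _ _
  pentagon _ _ _ _ := by ext; exact Bicategory.pentagon _ _ _ _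
  triangle _ _ := by ext; exact Bicategory.triangle _ _

@[simp] lemma whiskerLeft_base {x y z : El W} (p : x ⟶ y) {q r : y ⟶ z} (δ : q ⟶ r) :
    (p ◁ δ).base = p.base ◁ δ.base := rfl
@[simp] lemma whiskerRight_base {x y z : El W} {p q : x ⟶ y} (δ : p ⟶ q) (r : y ⟶ z) :
    (δ ▷ r).base = δ.base ▷ r.base := rfl

lemma hom_ext {x y : El W} {p q : x ⟶ y} (h : p.base = q.base)
    (h' : p.fiber = (W.map₂ (eqToHom h)).toNatTrans.app x.fiber ≫ q.fiber) : p = q := by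
  obtain ⟨f, α⟩ := p
  obtain ⟨g, β⟩ := q
  obtain rfl : f = g := h
  congr 1
  simpa using h'

lemma eqToHom_base {x y : El W} {p q : x ⟶ y} (h : p = q) :
    (eqToHom h).base = eqToHom (congrArg Hom.base h) := by
  subst h; rfl

instance [Strict A] : Strict (El W) where
  id_comp p := hom_ext (Strict.id_comp _) (by
    rw [← eqToIso.hom, ← Strict.leftUnitor_eqToIso]; exact (λ_ p).hom.w)
  comp_id p := hom_ext (Strict.comp_id _) (by
    rw [← eqToIso.hom, ← Strict.rightUnitor_eqToIso]; exact (ρ_ p).hom.w)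
  assoc p q r := hom_ext (Strict.assoc _ _ _) (by
    rw [← eqToIso.hom, ← Strict.associator_eqToIso]; exact (α_ p q r).hom.w)
  leftUnitor_eqToIso p := by
    ext
    rw [eqToIso.hom, eqToHom_base]
    exact congrArg Iso.hom (Strict.leftUnitor_eqToIso p.base)
  rightUnitor_eqToIso p := by
    ext
    rw [eqToIso.hom, eqToHom_base]
    exact congrArg Iso.hom (Strict.rightUnitor_eqToIso p.base)
  associator_eqToIso p q r := by
    ext
    rw [eqToIso.hom, eqToHom_base]
    exact congrArg Iso.hom (Strict.associator_eqToIso p.base q.base r.base)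

variable (W) in
/-- The projection 2-functor from the 2-category of elements of `W : A → Cat` to `A`. -/
def proj [Strict A] : StrictPseudofunctor (El W) A :=
  StrictPseudofunctor.mk''
    { obj := base
      map := Hom.base
      map₂ := Hom₂.base
      map₂_id := fun _ => rfl
      map₂_comp := fun _ _ => rfl
      map_id := fun _ => rfl
      map_comp := fun _ _ => rfl
      map₂_whisker_left := fun _ _ _ _ => by simp
      map₂_whisker_right := fun _ _ => by simp }

/-- The chosen cartesian morphisms `(f, id) : (a, X) ⟶ (b, W f X)` of the 2-category of elements. -/
def IsCart ⦃x y : El W⦄ (p : x ⟶ y) : Prop :=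
  ∃ h : (W.map p.base).toFunctor.obj x.fiber = y.fiber, p.fiber = eqToHom h

end El
end Elements

section Marked

variable {B : Type u₁} [Bicategory.{w₁, v₁} B] {E : Type u₂} [Bicategory.{w₂, v₂} E]

/-- A class of 1-cells of a bicategory. -/
abbrev Marking (B : Type u₁) [Bicategory.{w₁, v₁} B] := ∀ ⦃a b : B⦄, (a ⟶ b) → Prop

/-- A lax natural transformation is marked with respect to a class `P` of 1-cells
if its structure 2-cell on every 1-cell of `P` is an identity. -/
def isMarked (P : Marking B) (M N : B ⥤ᴸ E) : ObjectProperty (M ⟶ N) := fun η =>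
  ∀ ⦃a b : B⦄ (f : a ⟶ b), P f →
    ∃ h : η.app a ≫ N.map f = M.map f ≫ η.app b, η.naturality f = eqToHom h

lemma isMarked_comp [Strict E] {P : Marking B} {M N R : B ⥤ᴸ E} {η : M ⟶ N} {θ : N ⟶ R}
    (hη : isMarked P M N η) (hθ : isMarked P N R θ) : isMarked P M R (η ≫ θ) := by
  intro a b f hf
  obtain ⟨h, e⟩ := hη f hf
  obtain ⟨h', e'⟩ := hθ f hf
  refine ⟨?_, ?_⟩
  · simp only [Lax.LaxTrans.comp_app]
    rw [Strict.assoc, h', ← Strict.assoc, h, Strict.assoc]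
  · simp [e, e', Strict.associator_eqToIso]; rfl

/-- The category of `P`-marked lax natural transformations `M ⟶ N` and modifications. -/
abbrev MarkedLaxTrans (P : Marking B) (M N : B ⥤ᴸ E) := (isMarked P M N).FullSubcategory

end Marked

section ToCat

variable {B : Type u₁} [Bicategory.{w₁, v₁} B] {M N : B ⥤ᴸ Cat.{w, v}}

lemma conj_eqToHom_app {X Y : Cat.{w, v}} {F G H I : X ⟶ Y} (h : F = G) (η : G ⟶ H)
    (h' : H = I) (x : X) :
    (eqToHom h ≫ η ≫ eqToHom h').toNatTrans.app x =
      eqToHom (by rw [h]) ≫ η.toNatTrans.app x ≫ eqToHom (by rw [h']) := by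
  subst h h'; simp

lemma exists_eq_eqToHom {X Y : Cat.{w, v}} {F G : X ⟶ Y} (η : F ⟶ G)
    (h : ∀ x, F.toFunctor.obj x = G.toFunctor.obj x)
    (h' : ∀ x, η.toNatTrans.app x = eqToHom (h x)) : ∃ e : F = G, η = eqToHom e := by
  have e : F = G := Cat.ext (CategoryTheory.Functor.ext h fun x y t => by
    have := η.toNatTrans.naturality t
    rw [h', h'] at this
    rw [← reassoc_of% this]
    simp)
  refine ⟨e, ?_⟩
  ext x
  rw [h', Cat.eqToHom_app]

/-- A lax natural transformation between `Cat`-valued lax functors from its pointwise data. -/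
def mkLaxTrans (app : ∀ b : B, M.obj b ⥤ N.obj b)
    (τ : ∀ {a b : B} (f : a ⟶ b) (x : M.obj a),
      (N.map f).toFunctor.obj ((app a).obj x) ⟶ (app b).obj ((M.map f).toFunctor.obj x))
    (τ_nat : ∀ {a b : B} (f : a ⟶ b) {x y : M.obj a} (t : x ⟶ y),
      (N.map f).toFunctor.map ((app a).map t) ≫ τ f y =
        τ f x ≫ (app b).map ((M.map f).toFunctor.map t))
    (τ_nat₂ : ∀ {a b : B} {f g : a ⟶ b} (δ : f ⟶ g) (x : M.obj a),
      τ f x ≫ (app b).map ((M.map₂ δ).toNatTrans.app x) =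
        (N.map₂ δ).toNatTrans.app ((app a).obj x) ≫ τ g x)
    (τ_id : ∀ (a : B) (x : M.obj a),
      (N.mapId a).toNatTrans.app ((app a).obj x) ≫ τ (𝟙 a) x =
        (app a).map ((M.mapId a).toNatTrans.app x))
    (τ_comp : ∀ {a b c : B} (f : a ⟶ b) (g : b ⟶ c) (x : M.obj a),
      (N.mapComp f g).toNatTrans.app ((app a).obj x) ≫ τ (f ≫ g) x =
        (N.map g).toFunctor.map (τ f x) ≫ τ g ((M.map f).toFunctor.obj x) ≫
          (app c).map ((M.mapComp f g).toNatTrans.app x)) :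
    M ⟶ N where
  app b := (app b).toCatHom
  naturality f := Cat.Hom₂.ofNatTrans { app := τ f, naturality := fun _ _ t => τ_nat f t }
  naturality_naturality δ := by ext x; exact τ_nat₂ δ x
  naturality_id a := by
    ext x
    refine (τ_id a x).trans ?_
    change _ = 𝟙 _ ≫ 𝟙 _ ≫ (app a).map ((M.mapId a).toNatTrans.app x)
    simp
  naturality_comp f g := by
    ext x
    refine (τ_comp f g x).trans ?_
    change _ = 𝟙 _ ≫ (N.map g).toFunctor.map (τ f x) ≫ 𝟙 _ ≫ τ g _ ≫ 𝟙 _ ≫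
      (app _).map ((M.mapComp f g).toNatTrans.app x)
    simp

variable (η : M ⟶ N)

lemma lax_nat {a b : B} (f : a ⟶ b) {x y : M.obj a} (t : x ⟶ y) :
    (N.map f).toFunctor.map ((η.app a).toFunctor.map t) ≫ (η.naturality f).toNatTrans.app y =
      (η.naturality f).toNatTrans.app x ≫
        (η.app b).toFunctor.map ((M.map f).toFunctor.map t) :=
  (η.naturality f).toNatTrans.naturality t

lemma lax_nat₂ {a b : B} {f g : a ⟶ b} (δ : f ⟶ g) (x : M.obj a) :
    (η.naturality f).toNatTrans.app x ≫ (η.app b).toFunctor.map ((M.map₂ δ).toNatTrans.app x) =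
      (N.map₂ δ).toNatTrans.app ((η.app a).toFunctor.obj x) ≫
        (η.naturality g).toNatTrans.app x :=
  congrArg (fun z => z.toNatTrans.app x) (η.naturality_naturality δ)

lemma lax_id (a : B) (x : M.obj a) :
    (N.mapId a).toNatTrans.app ((η.app a).toFunctor.obj x) ≫
        (η.naturality (𝟙 a)).toNatTrans.app x =
      (η.app a).toFunctor.map ((M.mapId a).toNatTrans.app x) := by
  refine (congrArg (fun z => z.toNatTrans.app x) (η.naturality_id a)).trans ?_
  change 𝟙 _ ≫ 𝟙 _ ≫ (η.app a).toFunctor.map ((M.mapId a).toNatTrans.app x) = _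
  simp

lemma lax_comp {a b c : B} (f : a ⟶ b) (g : b ⟶ c) (x : M.obj a) :
    (N.mapComp f g).toNatTrans.app ((η.app a).toFunctor.obj x) ≫
        (η.naturality (f ≫ g)).toNatTrans.app x =
      (N.map g).toFunctor.map ((η.naturality f).toNatTrans.app x) ≫
        (η.naturality g).toNatTrans.app ((M.map f).toFunctor.obj x) ≫
          (η.app c).toFunctor.map ((M.mapComp f g).toNatTrans.app x) := by
  refine (congrArg (fun z => z.toNatTrans.app x) (η.naturality_comp f g)).trans ?_
  change 𝟙 _ ≫ (N.map g).toFunctor.map ((η.naturality f).toNatTrans.app x) ≫ 𝟙 _ ≫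
    (η.naturality g).toNatTrans.app _ ≫ 𝟙 _ ≫
      (η.app c).toFunctor.map ((M.mapComp f g).toNatTrans.app x) = _
  simp

/-- The morphism that a lax natural transformation `η : M ⟶ N` of `Cat`-valued functors assigns
to a morphism `α : M f X ⟶ Y`: the structure 2-cell of `η` at `f` followed by `η_b α`. -/
def laxMap {a b : B} (f : a ⟶ b) {X : M.obj a} {Y : M.obj b}
    (α : (M.map f).toFunctor.obj X ⟶ Y) :
    (N.map f).toFunctor.obj ((η.app a).toFunctor.obj X) ⟶ (η.app b).toFunctor.obj Y :=
  (η.naturality f).toNatTrans.app X ≫ (η.app b).toFunctor.map α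

lemma laxMap_nat₂ {a b : B} {f g : a ⟶ b} (δ : f ⟶ g) {X : M.obj a} {Y : M.obj b}
    {α : (M.map f).toFunctor.obj X ⟶ Y} {β : (M.map g).toFunctor.obj X ⟶ Y}
    (h : α = (M.map₂ δ).toNatTrans.app X ≫ β) :
    laxMap η f α = (N.map₂ δ).toNatTrans.app _ ≫ laxMap η g β := by
  have := lax_nat₂ η δ X
  simp only [laxMap, h, Functor.map_comp]
  rw [reassoc_of% this]

lemma laxMap_id {a : B} {X : M.obj a} {α : (M.map (𝟙 a)).toFunctor.obj X ⟶ X}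
    (h : (M.mapId a).toNatTrans.app X ≫ α = 𝟙 X) :
    (N.mapId a).toNatTrans.app _ ≫ laxMap η (𝟙 a) α = 𝟙 _ := by
  have := lax_id η a X
  simp only [laxMap]
  rw [reassoc_of% this, ← Functor.map_comp, h]
  exact (η.app a).toFunctor.map_id X

lemma laxMap_comp {a b c : B} {f : a ⟶ b} {g : b ⟶ c} {X : M.obj a} {Y : M.obj b} {Z : M.obj c}
    {α : (M.map f).toFunctor.obj X ⟶ Y} {β : (M.map g).toFunctor.obj Y ⟶ Z}
    {γ : (M.map (f ≫ g)).toFunctor.obj X ⟶ Z}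
    (h : (M.mapComp f g).toNatTrans.app X ≫ γ = (M.map g).toFunctor.map α ≫ β) :
    (N.mapComp f g).toNatTrans.app _ ≫ laxMap η (f ≫ g) γ =
      (N.map g).toFunctor.map (laxMap η f α) ≫ laxMap η g β := by
  have h₁ := lax_comp η f g X
  have h₂ := lax_nat η g α
  simp only [laxMap, Functor.map_comp, Category.assoc]
  rw [reassoc_of% h₁, reassoc_of% h₂, ← Functor.map_comp, h, Functor.map_comp]

lemma laxMap_eqToHom {a b : B} {f : a ⟶ b} {X : M.obj a} {Y : M.obj b}
    {α : (M.map f).toFunctor.obj X ⟶ Y} (h : ∃ h, α = eqToHom h)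
    (h' : ∃ h, η.naturality f = eqToHom h) : ∃ h, laxMap η f α = eqToHom h := by
  obtain ⟨h, rfl⟩ := h
  obtain ⟨h', e⟩ := h'
  refine ⟨(congrArg (fun z => z.toFunctor.obj X) h').trans (congrArg (η.app b).toFunctor.obj h), ?_⟩
  simp [laxMap, e, eqToHom_map]

end ToCat

section Hom

variable {B : Type u₁} [Bicategory.{w₁, v₁} B]
  {C : Type u₂} [Bicategory.{w, v} C] [Strict C]

/-- The representable 2-functor `C(U, -) : C → Cat`. -/
def homFunctor (U : C) : StrictPseudofunctor C Cat.{w, v} :=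
  StrictPseudofunctor.mk''
    { obj := fun X => Cat.of (U ⟶ X)
      map := fun f => (postcomp U f).toCatHom
      map₂ := fun {X Y} f g δ => ((postcomposing U X Y).map δ).toCatHom₂
      map₂_id := fun _ => by ext x; simp; rfl
      map₂_comp := fun _ _ => by ext x; simp; rfl
      map_id := fun X => by
        apply Cat.ext
        refine CategoryTheory.Functor.ext (fun x => Strict.comp_id x) (fun x y δ => ?_)
        have h : ∀ {x y : U ⟶ X} (δ : x ⟶ y), δ ▷ 𝟙 X = _ := whiskerRight_id
        simp only [Strict.rightUnitor_eqToIso] at h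
        exact h δ
      map_comp := fun {X Y Z} f g => by
        apply Cat.ext
        refine CategoryTheory.Functor.ext (fun x => (Strict.assoc x f g).symm) (fun x y δ => ?_)
        have h : ∀ {x y : U ⟶ X} (δ : x ⟶ y), δ ▷ (f ≫ g) = _ :=
          fun δ => whiskerRight_comp δ f g
        simp only [Strict.associator_eqToIso] at h
        exact h δ
      map₂_whisker_left := fun {X Y Z} f g g' δ => by
        have h : ∀ x : U ⟶ X, x ◁ (f ◁ δ) = _ := fun x => comp_whiskerLeft_symm x f δ
        simp only [Strict.associator_eqToIso] at h
        ext x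
        refine Eq.trans ?_ (conj_eqToHom_app _ _ _ x).symm
        exact h x
      map₂_whisker_right := fun {X Y Z f f'} δ g => by
        have h : ∀ x : U ⟶ X, x ◁ (δ ▷ g) = _ := fun x => whisker_assoc_symm x δ g
        simp only [Strict.associator_eqToIso] at h
        ext x
        refine Eq.trans ?_ (conj_eqToHom_app _ _ _ x).symm
        exact h x }

/-- The 2-functor `C(U, K -) : B → Cat`. -/
def homComp (K : StrictPseudofunctor B C) (U : C) : StrictPseudofunctor B Cat.{w, v} :=
  K.comp (homFunctor U)

@[simp] lemma homComp_obj (K : StrictPseudofunctor B C) (U : C) (b : B) :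
    (homComp K U).obj b = Cat.of (U ⟶ K.obj b) := rfl

@[simp] lemma homComp_map (K : StrictPseudofunctor B C) (U : C) {a b : B} (f : a ⟶ b) :
    (homComp K U).map f = (postcomp U (K.map f)).toCatHom := rfl

@[simp] lemma homComp_map₂_app (K : StrictPseudofunctor B C) (U : C) {a b : B} {f g : a ⟶ b}
    (δ : f ⟶ g) (x : U ⟶ K.obj a) :
    ((homComp K U).map₂ δ).toNatTrans.app x = x ◁ K.map₂ δ := rfl

lemma homComp_mapId_app (K : StrictPseudofunctor B C) (U : C) (a : B) (x : U ⟶ K.obj a) :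
    ((homComp K U).toLax.mapId a).toNatTrans.app x = (ρ_ x).inv ≫ x ◁ (K.mapId a).inv := by
  have h : (homComp K U).mapId a = eqToIso ((homComp K U).map_id a) :=
    (homComp K U).mapId_eq_eqToIso a
  rw [Pseudofunctor.toLax_mapId, h, eqToIso.inv]
  refine (Cat.eqToHom_app _ _ _ _).trans ?_
  rw [K.mapId_eq_eqToIso, Strict.rightUnitor_eqToIso]
  simp
  rfl

lemma homComp_mapComp_app (K : StrictPseudofunctor B C) (U : C) {a b c : B} (f : a ⟶ b)
    (g : b ⟶ c) (x : U ⟶ K.obj a) :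
    ((homComp K U).toLax.mapComp f g).toNatTrans.app x =
      (α_ x (K.map f) (K.map g)).hom ≫ x ◁ (K.mapComp f g).inv := by
  have h : (homComp K U).mapComp f g = eqToIso ((homComp K U).map_comp f g) :=
    (homComp K U).mapComp_eq_eqToIso f g
  rw [Pseudofunctor.toLax_mapComp, h, eqToIso.inv]
  refine (Cat.eqToHom_app _ _ _ _).trans ?_
  rw [K.mapComp_eq_eqToIso, Strict.associator_eqToIso]
  simp
  rfl

/-- For `u : U' ⟶ U`, the 2-natural transformation `C(u, K -) : C(U, K -) ⟶ C(U', K -)`,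
given by precomposition with `u`. -/
def homMap (K : StrictPseudofunctor B C) {U U' : C} (u : U' ⟶ U) :
    (homComp K U).toLax ⟶ (homComp K U').toLax :=
  mkLaxTrans (fun b => precomp (K.obj b) u) (fun f x => (α_ u x (K.map f)).hom)
    (fun {a b} f x y t => by
      have h : ∀ {x y : U ⟶ K.obj a} (t : x ⟶ y), (u ◁ t) ▷ K.map f ≫ (α_ u y (K.map f)).hom =
        (α_ u x (K.map f)).hom ≫ u ◁ (t ▷ K.map f) := by simp
      exact h t)
    (fun {a b f g} δ x => by
      have h : ∀ x : U ⟶ K.obj a, (α_ u x (K.map f)).hom ≫ u ◁ (x ◁ K.map₂ δ) =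
        (u ≫ x) ◁ K.map₂ δ ≫ (α_ u x (K.map g)).hom := by simp
      exact h x)
    (fun a x => by
      have h : ∀ x : U ⟶ K.obj a,
        ((ρ_ (u ≫ x)).inv ≫ (u ≫ x) ◁ (K.mapId a).inv) ≫ (α_ u x (K.map (𝟙 a))).hom =
          u ◁ ((ρ_ x).inv ≫ x ◁ (K.mapId a).inv) := by simp
      refine Eq.trans ?_ ((h x).trans ?_)
      · exact congrArg (· ≫ (α_ u x (K.map (𝟙 a))).hom) (homComp_mapId_app K U' a (u ≫ x))
      · exact congrArg (u ◁ ·) (homComp_mapId_app K U a x).symm)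
    (fun {a b c} f g x => by
      have h : ∀ x : U ⟶ K.obj a,
        ((α_ (u ≫ x) (K.map f) (K.map g)).hom ≫ (u ≫ x) ◁ (K.mapComp f g).inv) ≫
          (α_ u x (K.map (f ≫ g))).hom =
        (α_ u x (K.map f)).hom ▷ K.map g ≫ (α_ u (x ≫ K.map f) (K.map g)).hom ≫
          u ◁ ((α_ x (K.map f) (K.map g)).hom ≫ x ◁ (K.mapComp f g).inv) := by simp
      refine Eq.trans ?_ ((h x).trans ?_)
      · exact congrArg (· ≫ (α_ u x (K.map (f ≫ g))).hom) (homComp_mapComp_app K U' f g (u ≫ x))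
      · exact congrArg (fun z => (α_ u x (K.map f)).hom ▷ K.map g ≫
          (α_ u (x ≫ K.map f) (K.map g)).hom ≫ u ◁ z) (homComp_mapComp_app K U f g x).symm)

lemma isMarked_homMap (P : Marking B) (K : StrictPseudofunctor B C) {U U' : C} (u : U' ⟶ U) :
    isMarked P _ _ (homMap K u) := by
  intro a b f _
  refine exists_eq_eqToHom _ (fun x => Strict.assoc (B := C) u x (K.map f)) (fun x => ?_)
  have h : ∀ x : U ⟶ K.obj a, (α_ u x (K.map f)).hom = _ :=
    fun x => congrArg Iso.hom (Strict.associator_eqToIso u x (K.map f))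
  exact h x

/-- For `ν : u ⟶ u'`, the modification `C(ν, K -) : C(u, K -) ⟶ C(u', K -)`,
given by whiskering with `ν`. -/
def homMap₂ (K : StrictPseudofunctor B C) {U U' : C} {u u' : U' ⟶ U} (ν : u ⟶ u') :
    homMap K u ⟶ homMap K u' where
  as :=
    { app := fun b => ((precomposing U' U (K.obj b)).map ν).toCatHom₂
      naturality := fun {a b} f => by
        have h : ∀ x : U ⟶ K.obj a, (ν ▷ x) ▷ K.map f ≫ (α_ u' x (K.map f)).hom =
          (α_ u x (K.map f)).hom ≫ ν ▷ (x ≫ K.map f) := by simp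
        ext x
        exact h x }

variable (P : Marking B) (M : B ⥤ᴸ Cat.{w, v}) (K : StrictPseudofunctor B C)

/-- The category of `P`-marked lax natural transformations `M ⟶ C(U, K -)`. -/
abbrev Cone (U : C) := MarkedLaxTrans P M (homComp K U).toLax

variable {P M K}

/-- Precomposition of cones with `u : U' ⟶ U`, as a functor. -/
def Cone.restrict {U U' : C} (u : U' ⟶ U) : Cone P M K U ⥤ Cone P M K U' :=
  ObjectProperty.lift _ (ObjectProperty.ι _ ⋙ postcomp M (homMap K u))
    (fun c => isMarked_comp c.property (isMarked_homMap P K u))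

/-- Precomposition of cones with a 2-cell `ν : u ⟶ u'`, as a natural transformation. -/
def Cone.restrict₂ {U U' : C} {u u' : U' ⟶ U} (ν : u ⟶ u') :
    Cone.restrict (P := P) (M := M) (K := K) u ⟶ Cone.restrict u' where
  app c := ObjectProperty.homMk (c.obj ◁ homMap₂ K ν)
  naturality _ _ m :=
    ObjectProperty.hom_ext _ (whisker_exchange m.hom (homMap₂ K ν)).symm

variable (P M K) in
/-- An isomorphism of categories `C(U, L) ≅ Cone(U)`, 2-natural in `U`. -/
structure Representation (L : C) where
  /-- the functor from morphisms to cones -/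
  hom (U : C) : (U ⟶ L) ⥤ Cone P M K U
  /-- the functor from cones to morphisms -/
  inv (U : C) : Cone P M K U ⥤ (U ⟶ L)
  hom_inv (U : C) : hom U ⋙ inv U = 𝟭 (U ⟶ L)
  inv_hom (U : C) : inv U ⋙ hom U = 𝟭 (Cone P M K U)
  /-- naturality in the 1-cells of `C` -/
  natural {U U' : C} (u : U' ⟶ U) : precomp L u ⋙ hom U' = hom U ⋙ Cone.restrict u
  /-- naturality in the 2-cells of `C` -/
  natural₂ {U U' : C} {u u' : U' ⟶ U} (ν : u ⟶ u') (x : U ⟶ L) :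
    (hom U').map (ν ▷ x) =
      eqToHom (Functor.congr_obj (natural u) x) ≫ (Cone.restrict₂ ν).app ((hom U).obj x) ≫
        eqToHom (Functor.congr_obj (natural u') x).symm

/-- The cone `c` with vertex `L` exhibits `L` as the `P`-marked lax `M`-weighted limit of `K`:
there is an isomorphism of categories between `C(U, L)` and the category of cones with vertex `U`,
2-natural in `U`, which sends the identity of `L` to `c`. -/
def IsUniversal {L : C} (c : Cone P M K L) : Prop :=
  ∃ r : Representation P M K L, (r.hom L).obj (𝟙 L) = c

section Image

variable {D : Type u₃} [Bicategory.{w, v} D] [Strict D]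

/-- The 2-natural transformation `C(L, K -) ⟶ D(G L, G K -)` given by the action of `G`
on morphisms and 2-cells. -/
def homImage (K : StrictPseudofunctor B C) (G : StrictPseudofunctor C D) (L : C) :
    (homComp K L).toLax ⟶ (homComp (K.comp G) (G.obj L)).toLax :=
  mkLaxTrans (fun b => G.mapFunctor L (K.obj b)) (fun f x => (G.mapComp x (K.map f)).inv)
    (fun {a b} f x y t => by
      have h : ∀ {x y : L ⟶ K.obj a} (t : x ⟶ y),
        G.map₂ t ▷ G.map (K.map f) ≫ (G.mapComp y (K.map f)).inv =
          (G.mapComp x (K.map f)).inv ≫ G.map₂ (t ▷ K.map f) := by simp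
      exact h t)
    (fun {a b f g} δ x => by
      have h : ∀ x : L ⟶ K.obj a, (G.mapComp x (K.map f)).inv ≫ G.map₂ (x ◁ K.map₂ δ) =
        G.map x ◁ G.map₂ (K.map₂ δ) ≫ (G.mapComp x (K.map g)).inv := by simp
      exact h x)
    (fun a x => by
      have h : ∀ x : L ⟶ K.obj a,
        ((ρ_ (G.map x)).inv ≫ G.map x ◁ ((G.mapId (K.obj a)).inv ≫ G.map₂ (K.mapId a).inv)) ≫
          (G.mapComp x (K.map (𝟙 a))).inv = G.map₂ ((ρ_ x).inv ≫ x ◁ (K.mapId a).inv) := by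
        intro x
        have h : G.map₂ (ρ_ x).inv ≫ (G.mapComp x (𝟙 (K.obj a))).hom =
            (ρ_ (G.map x)).inv ≫ G.map x ◁ (G.mapId (K.obj a)).inv := by
          rw [G.mapComp_id_right_hom x, ← Category.assoc, ← G.map₂_comp, Iso.inv_hom_id,
            G.map₂_id, Category.id_comp]
        simp [reassoc_of% h]
      refine Eq.trans ?_ ((h x).trans ?_)
      · exact congrArg (· ≫ (G.mapComp x (K.map (𝟙 a))).inv)
          (homComp_mapId_app (K.comp G) (G.obj L) a (G.map x))
      · exact congrArg (G.map₂ ·) (homComp_mapId_app K L a x).symm)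
    (fun {a b c} f g x => by
      have h : ∀ x : L ⟶ K.obj a,
        ((α_ (G.map x) (G.map (K.map f)) (G.map (K.map g))).hom ≫
          G.map x ◁ ((G.mapComp (K.map f) (K.map g)).inv ≫ G.map₂ (K.mapComp f g).inv)) ≫
            (G.mapComp x (K.map (f ≫ g))).inv =
        (G.mapComp x (K.map f)).inv ▷ G.map (K.map g) ≫ (G.mapComp (x ≫ K.map f) (K.map g)).inv ≫
          G.map₂ ((α_ x (K.map f) (K.map g)).hom ≫ x ◁ (K.mapComp f g).inv) := by
        intro x
        simp
      refine Eq.trans ?_ ((h x).trans ?_)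
      · exact congrArg (· ≫ (G.mapComp x (K.map (f ≫ g))).inv)
          (homComp_mapComp_app (K.comp G) (G.obj L) f g (G.map x))
      · exact congrArg (fun z => (G.mapComp x (K.map f)).inv ▷ G.map (K.map g) ≫
          (G.mapComp (x ≫ K.map f) (K.map g)).inv ≫ G.map₂ z) (homComp_mapComp_app K L f g x).symm)

lemma isMarked_homImage (P : Marking B) (K : StrictPseudofunctor B C)
    (G : StrictPseudofunctor C D) (L : C) : isMarked P _ _ (homImage K G L) := by
  intro a b f _
  refine exists_eq_eqToHom _ (fun x => (G.map_comp x (K.map f)).symm) (fun x => ?_)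
  have h : ∀ x : L ⟶ K.obj a, (G.mapComp x (K.map f)).inv = _ :=
    fun x => congrArg Iso.inv (G.mapComp_eq_eqToIso x (K.map f))
  exact h x

/-- The image under the 2-functor `G` of a cone over `K`, a cone over `G ∘ K`. -/
def Cone.image (G : StrictPseudofunctor C D) {L : C} (c : Cone P M K L) :
    Cone P M (K.comp G) (G.obj L) :=
  ⟨c.obj ≫ homImage K G L, isMarked_comp c.property (isMarked_homImage P K G L)⟩

end Image

end Hom
section

variable {A : Type u₁} [Bicategory.{w₁, v₁} A] [Strict A] {C : Type u₂} [Bicategory.{w₂, v₂} C]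
  {W : StrictPseudofunctor A Cat.{w, v}}

lemma proj_comp_mapId (F : StrictPseudofunctor A C) (x : El W) :
    ((El.proj W).comp F).mapId x = F.mapId x.base :=
  (((El.proj W).comp F).mapId_eq_eqToIso x).trans (F.mapId_eq_eqToIso x.base).symm

lemma proj_comp_mapComp (F : StrictPseudofunctor A C) {x y z : El W} (p : x ⟶ y) (q : y ⟶ z) :
    ((El.proj W).comp F).mapComp p q = F.mapComp p.base q.base :=
  (((El.proj W).comp F).mapComp_eq_eqToIso p q).trans
    (F.mapComp_eq_eqToIso p.base q.base).symm

end

section Limits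

variable {A : Type u₁} [Bicategory.{w₁, v₁} A] [Strict A]
  {C : Type u₂} [Bicategory.{w, v} C] [Strict C]
  {D : Type u₃} [Bicategory.{w, v} D] [Strict D]

/-- The 2-functor `Δ1 : B → Cat` constant at the terminal category. -/
def deltaOne (B : Type u₁) [Bicategory.{w₁, v₁} B] [Strict B] :
    StrictPseudofunctor B Cat.{w, v} :=
  StrictPseudofunctor.mk''
    { obj := fun _ => Cat.chosenTerminal
      map := fun _ => 𝟙 Cat.chosenTerminal
      map₂ := fun _ => 𝟙 (𝟙 Cat.chosenTerminal)
      map₂_id := fun _ => rfl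
      map₂_comp := fun _ _ => (Category.comp_id _).symm
      map_id := fun _ => rfl
      map_comp := fun _ _ => (Strict.comp_id _).symm
      map₂_whisker_left := fun _ _ _ _ => by simp
      map₂_whisker_right := fun _ _ => by simp }

/-- The category of `W`-weighted cylinders over `F` with vertex `U`, that is of 2-natural
transformations `W ⟶ C(U, F -)` (lax ones, all of whose structure 2-cells are identities)
and modifications. -/
abbrev Cylinder (W : StrictPseudofunctor A Cat.{w, v}) (F : StrictPseudofunctor A C) (U : C) :=
  Cone (fun _ _ _ => True) W.toLax F U

/-- The category of cartesian-marked lax cones `Δ1 ⟶ C(U, K -)` over a 2-functor `K` defined on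
the 2-category of elements of `W`. -/
abbrev LaxCone {W : StrictPseudofunctor A Cat.{w, v}} (K : StrictPseudofunctor (El W) C) (U : C) :=
  Cone El.IsCart (deltaOne (El W)).toLax K U

variable {W : StrictPseudofunctor A Cat.{w, v}} {F : StrictPseudofunctor A C}

/-- The cylinder `c` is the universal cylinder of a `W`-weighted 2-limit of `F`. -/
def IsWeightedLimit {L : C} (c : Cylinder W F L) : Prop := IsUniversal c

/-- The cone `c` is the universal cone of a cartesian-marked lax conical limit of `K`. -/
def IsLaxConicalLimit {K : StrictPseudofunctor (El W) C} {L : C} (c : LaxCone K L) : Prop :=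
  IsUniversal c

/-- The cartesian-marked lax cone `c'` associated with a cylinder `c`: it is given by
`c' (a, X) = c_a X` on objects, and by `c_b α : c_b (W f X) ⟶ c_b Y` on morphisms
`(f, α) : (a, X) ⟶ (b, Y)`, precomposed with the identity `F f ∘ c_a X = c_b (W f X)`. -/
def Cylinder.toLaxCone {L : C} (c : Cylinder W F L) : LaxCone ((El.proj W).comp F) L where
  obj := mkLaxTrans
    (fun x => (Functor.const _).obj ((c.obj.app x.base).toFunctor.obj x.fiber))
    (fun p _ => laxMap c.obj p.base p.fiber)
    (fun {x y} p _ _ t => by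
      refine Eq.trans ?_ (Category.comp_id _).symm
      refine Eq.trans ?_ (Category.id_comp _)
      exact congrArg (· ≫ _) (CategoryTheory.Functor.map_id _ _))
    (fun {x y p q} δ _ => (Category.comp_id _).trans (laxMap_nat₂ c.obj δ.base δ.w))
    (fun x _ => by
      refine Eq.trans ?_ (laxMap_id c.obj (a := x.base) (X := x.fiber)
        (Cat.Hom.inv_hom_id_toNatTrans_app (W.mapId x.base) x.fiber))
      refine congrArg (· ≫ laxMap c.obj (𝟙 x.base) ((W.mapId x.base).hom.toNatTrans.app x.fiber)) ?_
      refine (homComp_mapId_app ((El.proj W).comp F) L x _).trans ?_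
      rw [proj_comp_mapId]
      exact (homComp_mapId_app F L x.base _).symm)
    (fun {x y z} p q _ => by
      refine Eq.trans ?_ ((laxMap_comp c.obj (α := p.fiber) (β := q.fiber)
        (γ := (p ≫ q).fiber) (Cat.Hom.inv_hom_id_toNatTrans_app_assoc
        (W.mapComp p.base q.base) x.fiber _)).trans ?_)
      · refine congrArg (· ≫ laxMap c.obj (p.base ≫ q.base) (p ≫ q).fiber) ?_
        refine (homComp_mapComp_app ((El.proj W).comp F) L p q _).trans ?_
        rw [proj_comp_mapComp]
        exact (homComp_mapComp_app F L p.base q.base _).symm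
      · exact congrArg (_ ≫ ·) (Category.comp_id _).symm)
  property x y p hp := by
    obtain ⟨h, e⟩ := laxMap_eqToHom c.obj hp (c.property p.base trivial)
    exact exists_eq_eqToHom _ (fun _ => h) (fun _ => e)

/-- `G` preserves `W`-weighted 2-limits of `F`. -/
def PreservesWeightedLimit (W : StrictPseudofunctor A Cat.{w, v}) (F : StrictPseudofunctor A C)
    (G : StrictPseudofunctor C D) : Prop :=
  ∀ ⦃L : C⦄ (c : Cylinder W F L), IsWeightedLimit c → IsWeightedLimit (Cone.image G c)

/-- `G` reflects `W`-weighted 2-limits of `F`. -/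
def ReflectsWeightedLimit (W : StrictPseudofunctor A Cat.{w, v}) (F : StrictPseudofunctor A C)
    (G : StrictPseudofunctor C D) : Prop :=
  ∀ ⦃L : C⦄ (c : Cylinder W F L), IsWeightedLimit (Cone.image G c) → IsWeightedLimit c

/-- `G` preserves cartesian-marked lax conical limits of `K`. -/
def PreservesLaxConicalLimit (K : StrictPseudofunctor (El W) C) (G : StrictPseudofunctor C D) :
    Prop :=
  ∀ ⦃L : C⦄ (c : LaxCone K L), IsLaxConicalLimit c → IsLaxConicalLimit (Cone.image G c)

/-- `G` reflects cartesian-marked lax conical limits of `K`. -/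
def ReflectsLaxConicalLimit (K : StrictPseudofunctor (El W) C) (G : StrictPseudofunctor C D) :
    Prop :=
  ∀ ⦃L : C⦄ (c : LaxCone K L), IsLaxConicalLimit (Cone.image G c) → IsLaxConicalLimit c

end Limits
end TwoLim

/-! In the 2-category of elements every morphism `(f, α)` factors, up to unitors, as the chosen
cartesian morphism `(f, 1)` followed by the vertical morphism `(1, α)`. A lax cone over `F ∘ π` is
therefore determined by its legs, its cells at vertical morphisms and its cells at the `(f, 1)`.
Over a fixed `a` the legs and vertical cells form a functor `W a ⥤ C(U, F a)` (`fibFunctor`). The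
marking makes the cells at the `(f, 1)` identities, which says exactly that these functors are
strictly natural in `a`. So a cartesian-marked lax cone is the same thing as a `W`-cylinder.

The factorization is used through `cellOf_fibMap` and `fibMap_cellOf`. The correspondence extends to
modifications and is 2-natural in the vertex, giving the isomorphism `coneIso`, which sends a
cylinder to its associated cone. Universality passes along any such isomorphism
(`ConeIso.isUniversal_iff`), since a representation can be composed with it.

For the statements about `G`, forming the associated cone commutes with applying `G`
(`isLaxConicalLimit_image_iff`). The statements about all limits also need that every lax cone is
associated with some cylinder (`toLaxCone_toCylinder`). -/

namespace TwoLim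

/-! ### Transport of universality along 2-natural isomorphisms of cone categories. -/

section ConeIso

variable {B : Type u₁} [Bicategory.{w₁, v₁} B] {B' : Type u₃} [Bicategory.{w₂, v₂} B']
  {C : Type u₂} [Bicategory.{w, v} C] [Strict C]

/-- An isomorphism between the categories of cones over `K` and over `K'`, 2-natural in the
vertex. -/
structure ConeIso (P : Marking B) (M : B ⥤ᴸ Cat.{w, v}) (K : StrictPseudofunctor B C)
    (P' : Marking B') (M' : B' ⥤ᴸ Cat.{w, v}) (K' : StrictPseudofunctor B' C) where
  /-- the functor from cones over `K` to cones over `K'` -/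
  hom (U : C) : Cone P M K U ⥤ Cone P' M' K' U
  /-- the functor from cones over `K'` to cones over `K` -/
  inv (U : C) : Cone P' M' K' U ⥤ Cone P M K U
  hom_inv (U : C) : hom U ⋙ inv U = 𝟭 _
  inv_hom (U : C) : inv U ⋙ hom U = 𝟭 _
  /-- naturality in the 1-cells of `C` -/
  natural {U U' : C} (u : U' ⟶ U) : Cone.restrict u ⋙ hom U' = hom U ⋙ Cone.restrict u
  /-- naturality in the 2-cells of `C` -/
  natural₂ {U U' : C} {u u' : U' ⟶ U} (ν : u ⟶ u') (c : Cone P M K U) :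
    (hom U').map ((Cone.restrict₂ ν).app c) =
      eqToHom (Functor.congr_obj (natural u) c) ≫ (Cone.restrict₂ ν).app ((hom U).obj c) ≫
        eqToHom (Functor.congr_obj (natural u') c).symm

namespace ConeIso

variable {P : Marking B} {M : B ⥤ᴸ Cat.{w, v}} {K : StrictPseudofunctor B C}
  {P' : Marking B'} {M' : B' ⥤ᴸ Cat.{w, v}} {K' : StrictPseudofunctor B' C}

lemma congr_app {C₁ : Type*} [Category* C₁] {C₂ : Type*} [Category* C₂] {F G : C₁ ⥤ C₂}
    (α : F ⟶ G) {x y : C₁} (h : x = y) :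
    α.app x = eqToHom (by rw [h]) ≫ α.app y ≫ eqToHom (by rw [h]) := by
  subst h; simp

lemma conj_eqToHom_cancel {C₁ : Type*} [Category* C₁] {a b c d x y : C₁} {f : a ⟶ b} {g : c ⟶ d}
    {h₁ : x = a} {h₂ : b = y} {h₃ : x = c} {h₄ : d = y}
    (h : eqToHom h₁ ≫ f ≫ eqToHom h₂ = eqToHom h₃ ≫ g ≫ eqToHom h₄) :
    f = eqToHom (h₁.symm.trans h₃) ≫ g ≫ eqToHom (h₄.trans h₂.symm) := by
  subst h₁ h₂ h₃ h₄; simpa using h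

lemma map_conj_eqToHom {C₁ : Type*} [Category* C₁] {C₂ : Type*} [Category* C₂] (H : C₁ ⥤ C₂)
    {a b c d : C₁} (h : a = b) (f : b ⟶ c) (h' : c = d) :
    H.map (eqToHom h ≫ f ≫ eqToHom h') =
      eqToHom (by rw [h]) ≫ H.map f ≫ eqToHom (by rw [h']) := by
  subst h h'; simp

lemma natural_inv (e : ConeIso P M K P' M' K') {U U' : C} (u : U' ⟶ U) :
    Cone.restrict u ⋙ e.inv U' = e.inv U ⋙ Cone.restrict u := by
  calc Cone.restrict u ⋙ e.inv U'
      = (e.inv U ⋙ e.hom U) ⋙ Cone.restrict u ⋙ e.inv U' := by rw [e.inv_hom]; rfl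
    _ = e.inv U ⋙ (e.hom U ⋙ Cone.restrict u) ⋙ e.inv U' := rfl
    _ = e.inv U ⋙ Cone.restrict u ⋙ e.hom U' ⋙ e.inv U' := by rw [← e.natural]; rfl
    _ = e.inv U ⋙ Cone.restrict u := by rw [e.hom_inv]; rfl

/-- The inverse of an isomorphism between categories of cones. -/
def symm (e : ConeIso P M K P' M' K') : ConeIso P' M' K' P M K where
  hom := e.inv
  inv := e.hom
  hom_inv := e.inv_hom
  inv_hom := e.hom_inv
  natural := e.natural_inv
  natural₂ {U U' u u'} ν c := by
    -- Apply `e.inv U'` to the naturality square of `e` at the cone `(e.inv U).obj c`. The round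
    -- trip on one side cancels by `hom_inv`, and `h` replaces the round trip of `c` on the other;
    -- only `eqToHom`s are left to move across.
    have h : (e.hom U).obj ((e.inv U).obj c) = c := Functor.congr_obj (e.inv_hom U) c
    have h₁ := congrArg (e.inv U').map (e.natural₂ ν ((e.inv U).obj c))
    have h₂ := Functor.congr_hom (e.hom_inv U') ((Cone.restrict₂ ν).app ((e.inv U).obj c))
    rw [congr_app (Cone.restrict₂ ν) h] at h₁
    simp only [Functor.map_comp, eqToHom_map, Category.assoc, eqToHom_trans,
      eqToHom_trans_assoc] at h₁
    simp only [Functor.comp_map, Functor.id_map] at h₂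
    rw [h₁] at h₂
    exact conj_eqToHom_cancel h₂

/-- Transport of a representation of one cone category along an isomorphism. -/
def representation (e : ConeIso P M K P' M' K') {L : C} (r : Representation P M K L) :
    Representation P' M' K' L where
  hom U := r.hom U ⋙ e.hom U
  inv U := e.inv U ⋙ r.inv U
  hom_inv U := by
    change r.hom U ⋙ (e.hom U ⋙ e.inv U) ⋙ r.inv U = _
    rw [e.hom_inv]
    exact r.hom_inv U
  inv_hom U := by
    change e.inv U ⋙ (r.inv U ⋙ r.hom U) ⋙ e.hom U = _
    rw [r.inv_hom]
    exact e.inv_hom U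
  natural {U U'} u := by
    change (precomp L u ⋙ r.hom U') ⋙ e.hom U' = _
    rw [r.natural]
    change r.hom U ⋙ Cone.restrict u ⋙ e.hom U' = _
    rw [e.natural]
    rfl
  natural₂ {U U' u u'} ν x := by
    refine (congrArg (e.hom U').map (r.natural₂ ν x)).trans ?_
    refine (map_conj_eqToHom _ _ _ _).trans ?_
    rw [e.natural₂]
    simp only [Category.assoc, eqToHom_trans, eqToHom_trans_assoc]
    rfl

lemma isUniversal_hom (e : ConeIso P M K P' M' K') {L : C} {c : Cone P M K L}
    (h : IsUniversal c) : IsUniversal ((e.hom L).obj c) := by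
  obtain ⟨r, rfl⟩ := h
  exact ⟨e.representation r, rfl⟩

lemma isUniversal_iff (e : ConeIso P M K P' M' K') {L : C} (c : Cone P M K L) :
    IsUniversal c ↔ IsUniversal ((e.hom L).obj c) := by
  refine ⟨e.isUniversal_hom, fun h => ?_⟩
  have := e.symm.isUniversal_hom h
  rwa [show (e.symm.hom L).obj ((e.hom L).obj c) = c from Functor.congr_obj (e.hom_inv L) c]
    at this

end ConeIso
end ConeIso

/-! ### Lax cones as legs and structure 2-cells. -/

section LaxCone

variable {A : Type u₁} [Bicategory.{w₁, v₁} A] [Strict A]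
  {C : Type u₂} [Bicategory.{w, v} C] [Strict C]
  {W : StrictPseudofunctor A Cat.{w, v}} {F : StrictPseudofunctor A C} {U : C}

/-- The object of the terminal category. -/
abbrev pt : Cat.chosenTerminal.{w, v} := ⟨⟨⟨⟩⟩⟩

namespace LaxCone

section

variable {K : StrictPseudofunctor (El W) C}

/-- The 1-cells `U ⟶ K x` of a lax cone over `K`. -/
def leg (d : LaxCone K U) (x : El W) : U ⟶ K.obj x :=
  (d.obj.app x).toFunctor.obj pt

/-- The terminal category has only the identity of `pt`, and this holds definitionally, so `map_id`
at `pt` applies to any `f`. -/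
lemma app_map (d : LaxCone K U) (x : El W) {s t : Cat.chosenTerminal.{w, v}} (f : s ⟶ t) :
    (d.obj.app x).toFunctor.map f = 𝟙 (leg d x) :=
  (d.obj.app x).toFunctor.map_id pt

/-- The structure 2-cells of a lax cone over `K`. -/
def cell (d : LaxCone K U) {x y : El W} (p : x ⟶ y) : leg d x ≫ K.map p ⟶ leg d y :=
  (d.obj.naturality p).toNatTrans.app pt

/-- The 2-cells of a modification of lax cones. -/
def mleg {d d' : LaxCone K U} (m : d ⟶ d') (x : El W) : leg d x ⟶ leg d' x :=
  (m.hom.as.app x).toNatTrans.app pt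

lemma cell_nat₂ (d : LaxCone K U) {x y : El W} {p q : x ⟶ y} (δ : p ⟶ q) :
    leg d x ◁ K.map₂ δ ≫ cell d q = cell d p := by
  refine (lax_nat₂ d.obj δ pt).symm.trans ?_
  exact (congrArg (cell d p ≫ ·) (app_map d y _)).trans (Category.comp_id _)

lemma cell_id (d : LaxCone K U) (x : El W) :
    ((ρ_ (leg d x)).inv ≫ leg d x ◁ (K.mapId x).inv) ≫ cell d (𝟙 x) = 𝟙 (leg d x) := by
  refine (congrArg (· ≫ cell d (𝟙 x)) (homComp_mapId_app K U x _)).symm.trans ?_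
  exact (lax_id d.obj x pt).trans (app_map d x _)

lemma cell_comp (d : LaxCone K U) {x y z : El W} (p : x ⟶ y) (q : y ⟶ z) :
    ((α_ (leg d x) (K.map p) (K.map q)).hom ≫ leg d x ◁ (K.mapComp p q).inv) ≫ cell d (p ≫ q) =
      cell d p ▷ K.map q ≫ cell d q := by
  refine (congrArg (· ≫ cell d (p ≫ q)) (homComp_mapComp_app K U p q _)).symm.trans ?_
  refine (lax_comp d.obj p q pt).trans ?_
  refine congrArg (cell d p ▷ K.map q ≫ ·) ?_
  exact (congrArg (cell d q ≫ ·) (app_map d z _)).trans (Category.comp_id _)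

lemma cell_cart (d : LaxCone K U) {x y : El W} (p : x ⟶ y) (hp : El.IsCart p) :
    ∃ h, cell d p = eqToHom h := by
  obtain ⟨h, e⟩ := d.property p hp
  refine ⟨congrArg (fun z => z.toFunctor.obj pt) h, ?_⟩
  exact (congrArg (fun z => z.toNatTrans.app pt) e).trans (Cat.eqToHom_app _ _ _ _)

lemma mleg_nat {d d' : LaxCone K U} (m : d ⟶ d') {x y : El W} (p : x ⟶ y) :
    mleg m x ▷ K.map p ≫ cell d' p = cell d p ≫ mleg m y :=
  congrArg (fun z => z.toNatTrans.app pt) (m.hom.as.naturality p)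

lemma hom_ext {d d' : LaxCone K U} {m m' : d ⟶ d'} (h : ∀ x, mleg m x = mleg m' x) : m = m' := by
  apply ObjectProperty.hom_ext
  apply Lax.LaxTrans.homCategory.ext
  intro x
  ext t
  exact h x

/-- Puts the `eqToHom` conjugations of `Functor.ext` and of 2-naturality in a form where only
components are compared. In `coneIso` these agree definitionally, so `HEq.rfl` suffices. -/
lemma eq_conj_eqToHom {d d' e e' : LaxCone K U} (h : d = e) (h' : e' = d') {n : d ⟶ d'}
    {m : e ⟶ e'} (hm : ∀ x, HEq (mleg n x) (mleg m x)) : n = eqToHom h ≫ m ≫ eqToHom h' := by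
  subst h h'
  rw [eqToHom_refl, eqToHom_refl, Category.id_comp, Category.comp_id]
  exact hom_ext fun x => eq_of_heq (hm x)

/-- A functor out of the terminal category is just an object, so legs and cells are all the data of
a cone; the rest is propositional. -/
lemma ext_of {d d' : LaxCone K U} (h : ∀ x, leg d x = leg d' x)
    (h' : ∀ {x y : El W} (p : x ⟶ y),
      cell d p = eqToHom (by rw [h]) ≫ cell d' p ≫ eqToHom (by rw [h])) : d = d' := by
  have happ : d.obj.app = d'.obj.app := by
    funext x
    exact Cat.ext (CategoryTheory.Functor.ext (fun _ => h x) (fun s t f => by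
      have {X Y : U ⟶ K.obj x} (h : X = Y) : 𝟙 X = eqToHom h ≫ 𝟙 Y ≫ eqToHom h.symm := by
        subst h; simp
      refine (app_map d x f).trans ((this (h x)).trans ?_)
      exact congrArg (fun z => eqToHom (h x) ≫ z ≫ eqToHom (h x).symm) (app_map d' x f).symm))
  obtain ⟨⟨app, nat, _, _, _⟩, _⟩ := d
  obtain ⟨⟨app', nat', _, _, _⟩, _⟩ := d'
  obtain rfl : app = app' := happ
  congr 2
  funext x y p
  ext t
  refine (h' p).trans ?_
  refine (Category.id_comp _).trans (Category.comp_id _)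

end

end LaxCone
end LaxCone

/-! ### Chosen cartesian morphisms and unit coherence. -/

section Elements

variable {A : Type u₁} [Bicategory.{w₁, v₁} A] {W : StrictPseudofunctor A Cat.{w, v}}

/-- The chosen cartesian morphism `(f, 1) : (a, X) ⟶ (b, W f X)` of the elements. -/
def El.cart {a b : A} (f : a ⟶ b) (X : W.obj a) :
    (⟨a, X⟩ : El W) ⟶ ⟨b, (W.map f).toFunctor.obj X⟩ :=
  ⟨f, 𝟙 _⟩

lemma El.isCart_cart {a b : A} (f : a ⟶ b) (X : W.obj a) : El.IsCart (El.cart f X) :=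
  ⟨rfl, rfl⟩

end Elements

section Unitors

variable {A : Type u₁} [Bicategory.{w₁, v₁} A] {C : Type u₂} [Bicategory.{w₂, v₂} C]

lemma map₂_rightUnitor_inv (F : StrictPseudofunctor A C) {a b : A} (f : a ⟶ b) :
    F.map₂ (ρ_ f).inv =
      (ρ_ (F.map f)).inv ≫ F.map f ◁ (F.mapId b).inv ≫ (F.mapComp f (𝟙 b)).inv := by
  simp [F.mapComp_id_right_inv]

lemma map₂_leftUnitor_inv (F : StrictPseudofunctor A C) {a b : A} (f : a ⟶ b) :
    F.map₂ (λ_ f).inv =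
      (λ_ (F.map f)).inv ≫ (F.mapId a).inv ▷ F.map f ≫ (F.mapComp (𝟙 a) f).inv := by
  simp [F.mapComp_id_left_inv]

end Unitors

/-! ### From lax cones over `F ∘ π` to cylinders over `F`. -/

namespace LaxCone

variable {A : Type u₁} [Bicategory.{w₁, v₁} A] [Strict A]
  {C : Type u₂} [Bicategory.{w, v} C] [Strict C]
  {W : StrictPseudofunctor A Cat.{w, v}} {F : StrictPseudofunctor A C} {U : C}

section

variable (d : LaxCone ((El.proj W).comp F) U)

/-- The 1-cell `U ⟶ F a` of a lax cone over `F ∘ π` at `(a, X)`. -/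
def legOf {a : A} (X : W.obj a) : U ⟶ F.obj a := leg d ⟨a, X⟩

/-- The structure 2-cell of a lax cone over `F ∘ π` at `(f, α)`. -/
def cellOf {a b : A} (f : a ⟶ b) {X : W.obj a} {Y : W.obj b}
    (α : (W.map f).toFunctor.obj X ⟶ Y) : legOf d X ≫ F.map f ⟶ legOf d Y :=
  cell d (x := ⟨a, X⟩) (y := ⟨b, Y⟩) ⟨f, α⟩

lemma cellOf_nat₂ {a b : A} {f g : a ⟶ b} (δ : f ⟶ g) {X : W.obj a} {Y : W.obj b}
    (β : (W.map g).toFunctor.obj X ⟶ Y) :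
    legOf d X ◁ F.map₂ δ ≫ cellOf d g β = cellOf d f ((W.map₂ δ).toNatTrans.app X ≫ β) :=
  cell_nat₂ d (x := ⟨a, X⟩) (y := ⟨b, Y⟩) (p := ⟨f, _⟩) (q := ⟨g, β⟩) ⟨δ, rfl⟩

lemma cellOf_id {a : A} (X : W.obj a) :
    (ρ_ (legOf d X)).inv ≫ legOf d X ◁ (F.mapId a).inv ≫
      cellOf d (𝟙 a) ((W.mapId a).hom.toNatTrans.app X) = 𝟙 (legOf d X) := by
  have h := cell_id d ⟨a, X⟩
  rw [proj_comp_mapId, Category.assoc] at h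
  exact h

lemma cellOf_comp {a b c : A} (f : a ⟶ b) (g : b ⟶ c) {X : W.obj a} {Y : W.obj b} {Z : W.obj c}
    (α : (W.map f).toFunctor.obj X ⟶ Y) (β : (W.map g).toFunctor.obj Y ⟶ Z) :
    (α_ (legOf d X) (F.map f) (F.map g)).hom ≫ legOf d X ◁ (F.mapComp f g).inv ≫
      cellOf d (f ≫ g) ((W.mapComp f g).hom.toNatTrans.app X ≫ (W.map g).toFunctor.map α ≫ β) =
      cellOf d f α ▷ F.map g ≫ cellOf d g β := by
  have h := cell_comp d (x := ⟨a, X⟩) (y := ⟨b, Y⟩) (z := ⟨c, Z⟩) ⟨f, α⟩ ⟨g, β⟩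
  rw [proj_comp_mapComp] at h
  exact (Category.assoc _ _ _).symm.trans h

/-- The 2-cell of a lax cone over `F ∘ π` at a morphism of `W a`. -/
def fibMap {a : A} {X Y : W.obj a} (t : X ⟶ Y) : legOf d X ⟶ legOf d Y :=
  (ρ_ (legOf d X)).inv ≫ legOf d X ◁ (F.mapId a).inv ≫
    cellOf d (𝟙 a) ((W.mapId a).hom.toNatTrans.app X ≫ t)

/-- Composing `(f, α)` with the vertical morphism `(1, t)` gives a morphism over `f ≫ 𝟙 b`, and the
inverse right unitor is a 2-cell to it from `(f, α ≫ t)`. Compatibility of the cells with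
composition (`h₁`) and with 2-cells (`h₂`) then gives the equation. -/
lemma cellOf_fibMap {a b : A} (f : a ⟶ b) {X : W.obj a} {Y Z : W.obj b}
    (α : (W.map f).toFunctor.obj X ⟶ Y) (t : Y ⟶ Z) :
    cellOf d f α ≫ fibMap d t = cellOf d f (α ≫ t) := by
  have h₁ := cellOf_comp d f (𝟙 b) α ((W.mapId b).hom.toNatTrans.app Y ≫ t)
  have h₂ := cellOf_nat₂ d (ρ_ f).inv ((W.mapComp f (𝟙 b)).hom.toNatTrans.app X ≫
    (W.map (𝟙 b)).toFunctor.map α ≫ (W.mapId b).hom.toNatTrans.app Y ≫ t)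
  have h₃ : (W.map₂ (ρ_ f).inv).toNatTrans.app X ≫ (W.mapComp f (𝟙 b)).hom.toNatTrans.app X ≫
    (W.map (𝟙 b)).toFunctor.map α ≫ (W.mapId b).hom.toNatTrans.app Y ≫ t = α ≫ t := by
    simp [map₂_rightUnitor_inv]
  have h₄ : cellOf d f α ≫ (ρ_ (legOf d Y)).inv ≫ legOf d Y ◁ (F.mapId b).inv =
      (ρ_ (legOf d X ≫ F.map f)).inv ≫ (legOf d X ≫ F.map f) ◁ (F.mapId b).inv ≫
        cellOf d f α ▷ F.map (𝟙 b) := by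
    rw [whisker_exchange, rightUnitor_inv_naturality_assoc]
  rw [h₃] at h₂
  rw [← h₂, fibMap, map₂_rightUnitor_inv, reassoc_of% h₄, ← h₁]
  -- What remains is unitor coherence in front of a common cell, whose form no longer matters.
  generalize cellOf d (f ≫ 𝟙 b) _ = z
  simp

/-- The mirror image of `cellOf_fibMap`: the vertical morphism comes first, so the left unitor takes
the place of the right one and `t` is transported by `W f`. -/
lemma fibMap_cellOf {a b : A} (f : a ⟶ b) {X Y : W.obj a} {Z : W.obj b} (t : X ⟶ Y)
    (α : (W.map f).toFunctor.obj Y ⟶ Z) :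
    fibMap d t ▷ F.map f ≫ cellOf d f α = cellOf d f ((W.map f).toFunctor.map t ≫ α) := by
  have h₁ := cellOf_comp d (𝟙 a) f ((W.mapId a).hom.toNatTrans.app X ≫ t) α
  have h₂ := cellOf_nat₂ d (λ_ f).inv ((W.mapComp (𝟙 a) f).hom.toNatTrans.app X ≫
    (W.map f).toFunctor.map ((W.mapId a).hom.toNatTrans.app X ≫ t) ≫ α)
  have h₃ : (W.map₂ (λ_ f).inv).toNatTrans.app X ≫ (W.mapComp (𝟙 a) f).hom.toNatTrans.app X ≫
    (W.map f).toFunctor.map ((W.mapId a).hom.toNatTrans.app X ≫ t) ≫ α =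
      (W.map f).toFunctor.map t ≫ α := by
    have h := Cat.Hom.inv_hom_id_toNatTrans_app (W.mapId a) X
    simp only [map₂_leftUnitor_inv, CategoryTheory.Functor.map_comp]
    simp only [Category.assoc, Cat.Hom₂.comp_app, Cat.leftUnitor_inv_app, Cat.whiskerRight_app,
      Cat.Hom.inv_hom_id_toNatTrans_app_assoc]
    refine (Category.id_comp _).trans ?_
    rw [← CategoryTheory.Functor.map_comp_assoc, h]
    exact (congrArg (· ≫ _) (CategoryTheory.Functor.map_id _ _)).trans (Category.id_comp _)
  rw [h₃] at h₂
  rw [← h₂, fibMap, map₂_leftUnitor_inv]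
  simp only [comp_whiskerRight, Category.assoc, ← h₁]
  simp

lemma fibMap_id {a : A} (X : W.obj a) : fibMap d (𝟙 X) = 𝟙 (legOf d X) := by
  refine Eq.trans ?_ (cellOf_id d X)
  exact congrArg (fun z => (ρ_ (legOf d X)).inv ≫ legOf d X ◁ (F.mapId a).inv ≫ cellOf d (𝟙 a) z)
    (Category.comp_id _)

/-- The case of `cellOf_fibMap` in which the first morphism is itself vertical. -/
lemma fibMap_comp {a : A} {X Y Z : W.obj a} (s : X ⟶ Y) (t : Y ⟶ Z) :
    fibMap d (s ≫ t) = fibMap d s ≫ fibMap d t := by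
  have h := cellOf_fibMap d (𝟙 a) ((W.mapId a).hom.toNatTrans.app X ≫ s) t
  rw [fibMap, fibMap, Category.assoc, Category.assoc, h]
  exact congrArg (fun z => (ρ_ (legOf d X)).inv ≫ legOf d X ◁ (F.mapId a).inv ≫ cellOf d (𝟙 a) z)
    (Category.assoc _ _ _).symm

/-- The functor `W a ⥤ C(U, F a)` given by a lax cone over `F ∘ π`. -/
def fibFunctor (a : A) : W.obj a ⥤ (homComp F U).obj a where
  obj X := legOf d X
  map t := fibMap d t
  map_id X := fibMap_id d X
  map_comp s t := fibMap_comp d s t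

lemma cellOf_cart {a b : A} (f : a ⟶ b) (X : W.obj a) :
    ∃ h, cellOf d f (𝟙 ((W.map f).toFunctor.obj X)) = eqToHom h :=
  cell_cart d (El.cart f X) (El.isCart_cart f X)

/-- The cylinder over `F` given by a lax cone over `F ∘ π`. -/
def toCylinder : Cylinder W F U where
  obj := mkLaxTrans (fun a => fibFunctor d a)
    (fun f X => cellOf d f (𝟙 ((W.map f).toFunctor.obj X)))
    -- Both sides of the naturality square equal the cell at `(f, W f t)`.
    (fun {a b} f X Y t => by
      refine (fibMap_cellOf d f t (𝟙 _)).trans ?_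
      rw [Category.comp_id, ← Category.id_comp ((W.map f).toFunctor.map t)]
      exact (cellOf_fibMap d f _ _).symm)
    (fun {a b f g} δ X => by
      refine (cellOf_fibMap d f _ _).trans ?_
      refine Eq.trans ?_ (cellOf_nat₂ d δ _).symm
      exact congrArg (cellOf d f) ((Category.id_comp _).trans (Category.comp_id _).symm))
    (fun a X => by
      refine (congrArg (· ≫ cellOf d (𝟙 a) (𝟙 _)) (homComp_mapId_app F U a _)).trans ?_
      refine (Category.assoc _ _ _).trans ?_
      -- The right-hand side is `fibMap` of the inverse comparison of `W` at `𝟙 a`; the forward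
      -- comparison built into `fibMap` cancels it.
      refine congrArg (fun z => (ρ_ (legOf d X)).inv ≫ legOf d X ◁ (F.mapId a).inv ≫
        cellOf d (𝟙 a) z) ?_
      exact (Cat.Hom.hom_inv_id_toNatTrans_app (W.mapId a) X).symm)
    (fun {a b c} f g X => by
      refine (congrArg (· ≫ cellOf d (f ≫ g) (𝟙 _)) (homComp_mapComp_app F U f g _)).trans ?_
      refine (Category.assoc _ _ _).trans ?_
      refine Eq.trans ?_ (congrArg (cellOf d f (𝟙 _) ▷ F.map g ≫ ·)
        (cellOf_fibMap d g (𝟙 _) ((W.mapComp f g).inv.toNatTrans.app X))).symm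
      refine Eq.trans ?_ (cellOf_comp d f g _ _)
      refine congrArg (fun z => (α_ (legOf d X) (F.map f) (F.map g)).hom ≫
        legOf d X ◁ (F.mapComp f g).inv ≫ cellOf d (f ≫ g) z) ?_
      rw [CategoryTheory.Functor.map_id, Category.id_comp]
      refine (Cat.Hom.hom_inv_id_toNatTrans_app (W.mapComp f g) X).symm.trans ?_
      exact congrArg ((W.mapComp f g).hom.toNatTrans.app X ≫ ·) (Category.id_comp _).symm)
  -- This is where the marking enters: identity cells at the `(f, 1)` make the lax transformation
  -- 2-natural.
  property a b f _ := by
    refine exists_eq_eqToHom _ (fun X => (cellOf_cart d f X).choose) (fun X => ?_)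
    exact (cellOf_cart d f X).choose_spec

end
end LaxCone
-- Composites and modifications of `Cat`-valued lax transformations.
section ToCat

variable {B : Type u₁} [Bicategory.{w₁, v₁} B] {M N R : B ⥤ᴸ Cat.{w, v}}

lemma comp_naturality_app (η : M ⟶ N) (θ : N ⟶ R) {a b : B} (f : a ⟶ b) (X : M.obj a) :
    ((η ≫ θ).naturality f).toNatTrans.app X =
      (θ.naturality f).toNatTrans.app ((η.app a).toFunctor.obj X) ≫
        (θ.app b).toFunctor.map ((η.naturality f).toNatTrans.app X) := by
  change 𝟙 _ ≫ (θ.naturality f).toNatTrans.app ((η.app a).toFunctor.obj X) ≫ 𝟙 _ ≫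
    (θ.app b).toFunctor.map ((η.naturality f).toNatTrans.app X) ≫ 𝟙 _ = _
  simp

/-- With `θ` equal to `homMap` or `homImage`, this shows that forming the associated cone commutes
with changing the vertex and with applying `G`. -/
lemma laxMap_comp_right (η : M ⟶ N) (θ : N ⟶ R) {a b : B} (f : a ⟶ b) {X : M.obj a}
    {Y : M.obj b} (α : (M.map f).toFunctor.obj X ⟶ Y) :
    laxMap (η ≫ θ) f α = (θ.naturality f).toNatTrans.app ((η.app a).toFunctor.obj X) ≫
      (θ.app b).toFunctor.map (laxMap η f α) := by
  rw [laxMap, comp_naturality_app, laxMap, CategoryTheory.Functor.map_comp]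
  exact Category.assoc _ _ _

/-- The modification axiom at `f` followed by naturality at `α`; it makes the components of a
morphism of cylinders a morphism of associated cones. -/
lemma laxMap_modification {η θ : M ⟶ N} (m : η ⟶ θ) {a b : B} (f : a ⟶ b) {X : M.obj a}
    {Y : M.obj b} (α : (M.map f).toFunctor.obj X ⟶ Y) :
    (N.map f).toFunctor.map ((m.as.app a).toNatTrans.app X) ≫ laxMap θ f α =
      laxMap η f α ≫ (m.as.app b).toNatTrans.app Y := by
  have h : (N.map f).toFunctor.map ((m.as.app a).toNatTrans.app X) ≫
      (θ.naturality f).toNatTrans.app X = (η.naturality f).toNatTrans.app X ≫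
        (m.as.app b).toNatTrans.app ((M.map f).toFunctor.obj X) :=
    congrArg (fun z => z.toNatTrans.app X) (m.as.naturality f)
  simp only [laxMap, Category.assoc]
  rw [reassoc_of% h]
  exact congrArg _ ((m.as.app b).toNatTrans.naturality α).symm

end ToCat

/-! ### Extensionality for cylinders and their morphisms. -/

section CylinderExt

variable {A : Type u₁} [Bicategory.{w₁, v₁} A]
  {C : Type u₂} [Bicategory.{w, v} C] [Strict C]
  {W : StrictPseudofunctor A Cat.{w, v}} {F : StrictPseudofunctor A C} {U : C}

namespace Cylinder

/-- Every structure 2-cell of a cylinder is an `eqToHom`, so it carries no data beyond the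
components. -/
lemma ext_of {c c' : Cylinder W F U} (h : ∀ a, c.obj.app a = c'.obj.app a) : c = c' := by
  obtain ⟨⟨app, nat, _, _, _⟩, hc⟩ := c
  obtain ⟨⟨app', nat', _, _, _⟩, hc'⟩ := c'
  obtain rfl : app = app' := funext h
  congr 2
  funext a b f
  obtain ⟨_, e⟩ := hc f trivial
  obtain ⟨_, e'⟩ := hc' f trivial
  exact e.trans e'.symm

lemma hom_ext {c c' : Cylinder W F U} {m m' : c ⟶ c'}
    (h : ∀ a X, (m.hom.as.app a).toNatTrans.app X = (m'.hom.as.app a).toNatTrans.app X) :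
    m = m' := by
  apply ObjectProperty.hom_ext
  apply Lax.LaxTrans.homCategory.ext
  intro a
  ext X
  exact h a X

lemma eq_conj_eqToHom {c c' e e' : Cylinder W F U} (h : c = e) (h' : e' = c') {n : c ⟶ c'}
    {m : e ⟶ e'} (hm : ∀ a X, HEq ((n.hom.as.app a).toNatTrans.app X)
      ((m.hom.as.app a).toNatTrans.app X)) : n = eqToHom h ≫ m ≫ eqToHom h' := by
  subst h h'
  rw [eqToHom_refl, eqToHom_refl, Category.id_comp, Category.comp_id]
  exact hom_ext fun a X => eq_of_heq (hm a X)

end Cylinder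

end CylinderExt

variable {A : Type u₁} [Bicategory.{w₁, v₁} A] [Strict A]
  {C : Type u₂} [Bicategory.{w, v} C] [Strict C]
  {W : StrictPseudofunctor A Cat.{w, v}} {F : StrictPseudofunctor A C} {U : C}

/-! ### The two constructions as mutually inverse functors. -/

namespace LaxCone

/-- A morphism of lax cones from its components. -/
def homOf {K : StrictPseudofunctor (El W) C} {d d' : LaxCone K U}
    (g : ∀ x, leg d x ⟶ leg d' x)
    (hg : ∀ {x y : El W} (p : x ⟶ y), g x ▷ K.map p ≫ cell d' p = cell d p ≫ g y) : d ⟶ d' :=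
  ObjectProperty.homMk
    { as :=
      { app x := Cat.Hom₂.ofNatTrans
          { app _ := g x
            naturality _ _ f := by
              refine (congrArg (· ≫ g x) (app_map d x f)).trans ((Category.id_comp _).trans ?_)
              exact ((congrArg (g x ≫ ·) (app_map d' x f)).trans (Category.comp_id _)).symm }
        naturality p := by
          ext t
          exact hg p } }

/-- The component at `(a, X)` of a morphism of lax cones over `F ∘ π`. -/
def mlegOf {d d' : LaxCone ((El.proj W).comp F) U} (m : d ⟶ d') {a : A} (X : W.obj a) :
    legOf d X ⟶ legOf d' X :=
  mleg m ⟨a, X⟩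

lemma mlegOf_nat {d d' : LaxCone ((El.proj W).comp F) U} (m : d ⟶ d') {a b : A} (f : a ⟶ b)
    {X : W.obj a} {Y : W.obj b} (α : (W.map f).toFunctor.obj X ⟶ Y) :
    mlegOf m X ▷ F.map f ≫ cellOf d' f α = cellOf d f α ≫ mlegOf m Y :=
  mleg_nat m (x := ⟨a, X⟩) (y := ⟨b, Y⟩) ⟨f, α⟩

/-- The modification axiom at a vertical morphism, with the unit isomorphisms moved past the
component by interchange. -/
lemma fibMap_mlegOf {d d' : LaxCone ((El.proj W).comp F) U} (m : d ⟶ d') {a : A} {X Y : W.obj a}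
    (t : X ⟶ Y) : fibMap d t ≫ mlegOf m Y = mlegOf m X ≫ fibMap d' t := by
  simp only [fibMap, Category.assoc, ← mlegOf_nat]
  rw [whisker_exchange_assoc, rightUnitor_inv_naturality_assoc]

/-- The functor sending a lax cone over `F ∘ π` to the corresponding cylinder over `F`. -/
def cylinderFunctor (W : StrictPseudofunctor A Cat.{w, v}) (F : StrictPseudofunctor A C) (U : C) :
    LaxCone ((El.proj W).comp F) U ⥤ Cylinder W F U where
  obj d := toCylinder d
  map {d d'} m := ObjectProperty.homMk
    { as :=
      { app a := Cat.Hom₂.ofNatTrans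
          { app X := mlegOf m X
            naturality _ _ t := fibMap_mlegOf m t }
        naturality {a b} f := by
          ext X
          exact mleg_nat m (El.cart f X) } }
  map_id _ := rfl
  map_comp _ _ := rfl

end LaxCone

namespace Cylinder

/-- The functor sending a cylinder to the associated lax cone. -/
def laxConeFunctor (W : StrictPseudofunctor A Cat.{w, v}) (F : StrictPseudofunctor A C) (U : C) :
    Cylinder W F U ⥤ LaxCone ((El.proj W).comp F) U where
  obj c := c.toLaxCone
  map {c c'} m := LaxCone.homOf (d := c.toLaxCone) (d' := c'.toLaxCone)
    (fun x => (m.hom.as.app x.base).toNatTrans.app x.fiber)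
    (fun p => laxMap_modification m.hom p.base p.fiber)
  map_id _ := rfl
  map_comp _ _ := rfl

/-- The unit law `laxMap_id` cancels the structure 2-cell at `𝟙 a` against the unit comparisons,
leaving only the action of `c` on `t`. -/
lemma fibMap_toLaxCone (c : Cylinder W F U) {a : A} {X Y : W.obj a} (t : X ⟶ Y) :
    LaxCone.fibMap c.toLaxCone t = (c.obj.app a).toFunctor.map t := by
  have h := laxMap_id c.obj (a := a) (X := X) (α := (W.mapId a).hom.toNatTrans.app X)
    (Cat.Hom.inv_hom_id_toNatTrans_app (W.mapId a) X)
  have h₁ : laxMap c.obj (𝟙 a) ((W.mapId a).hom.toNatTrans.app X ≫ t) =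
      laxMap c.obj (𝟙 a) ((W.mapId a).hom.toNatTrans.app X) ≫ (c.obj.app a).toFunctor.map t := by
    refine (congrArg (fun z => (c.obj.naturality (𝟙 a)).toNatTrans.app X ≫ z)
      ((c.obj.app a).toFunctor.map_comp _ _)).trans ?_
    exact (Category.assoc _ _ _).symm
  refine (Category.assoc _ _ _).symm.trans ?_
  refine (congrArg (· ≫ laxMap c.obj (𝟙 a) ((W.mapId a).hom.toNatTrans.app X ≫ t))
    (homComp_mapId_app F U a ((c.obj.app a).toFunctor.obj X)).symm).trans ?_
  refine (congrArg (fun z =>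
    ((homComp F U).toLax.mapId a).toNatTrans.app ((c.obj.app a).toFunctor.obj X) ≫ z) h₁).trans ?_
  refine (Category.assoc _ _ _).symm.trans ?_
  exact (congrArg (· ≫ _) h).trans (Category.id_comp _)

lemma toCylinder_toLaxCone (c : Cylinder W F U) : c.toLaxCone.toCylinder = c := by
  refine ext_of fun a => Cat.ext ?_
  refine CategoryTheory.Functor.ext (fun X => rfl) (fun X Y t => ?_)
  exact (fibMap_toLaxCone c t).trans ((Category.id_comp _).trans (Category.comp_id _)).symm

/-- The rebuilt cell at `(f, α)` is the cell at `(f, 1)` followed by `fibMap` of `α`, which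
`cellOf_fibMap` merges into the original cell. -/
lemma toLaxCone_toCylinder (d : LaxCone ((El.proj W).comp F) U) :
    d.toCylinder.toLaxCone = d := by
  refine LaxCone.ext_of (fun x => rfl) (fun {x y} p => ?_)
  refine (LaxCone.cellOf_fibMap d p.base (𝟙 _) p.fiber).trans ?_
  rw [Category.id_comp]
  exact ((Category.id_comp _).trans (Category.comp_id _)).symm

lemma restrict_toLaxCone {U' : C} (u : U' ⟶ U) (c : Cylinder W F U) :
    Cylinder.toLaxCone ((Cone.restrict u).obj c) = (Cone.restrict u).obj c.toLaxCone := by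
  refine LaxCone.ext_of (fun x => rfl) (fun {x y} p => ?_)
  refine (laxMap_comp_right c.obj (homMap F u) p.base p.fiber).trans ?_
  refine Eq.trans ?_ ((Category.id_comp _).trans (Category.comp_id _)).symm
  exact (comp_naturality_app c.toLaxCone.obj (homMap ((El.proj W).comp F) u) p pt).symm

end Cylinder
-- Comparing cones over propositionally equal diagrams.
section Congr

/-- Strictness forces the comparison isomorphisms to be `eqToIso`s, so they are determined by the
action on cells. -/
lemma strictPseudofunctor_ext {B : Type u₁} [Bicategory.{w₁, v₁} B] {C : Type u₂}
    [Bicategory.{w₂, v₂} C] {K K' : StrictPseudofunctor B C}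
    (h : K.toPrelaxFunctor = K'.toPrelaxFunctor) : K = K' := by
  obtain ⟨⟨⟨L, mapId, mapComp, _, _, _, _, _⟩, map_id, mapId_eq⟩, map_comp, mapComp_eq⟩ := K
  obtain ⟨⟨⟨L', mapId', mapComp', _, _, _, _, _⟩, map_id', mapId_eq'⟩, map_comp', mapComp_eq'⟩ := K'
  obtain rfl : L = L' := h
  obtain rfl : mapId = mapId' := funext fun a => (mapId_eq a).trans (mapId_eq' a).symm
  obtain rfl : @mapComp = @mapComp' := by
    funext a b c f g
    exact (mapComp_eq f g).trans (mapComp_eq' f g).symm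
  rfl

variable {A : Type u₁} [Bicategory.{w₁, v₁} A] [Strict A]
  {C : Type u₂} [Bicategory.{w, v} C] [Strict C]
  {W : StrictPseudofunctor A Cat.{w, v}}

lemma LaxCone.isLaxConicalLimit_congr {K K' : StrictPseudofunctor (El W) C} (h : K = K') {L : C}
    (d : LaxCone K L) (d' : LaxCone K' L) (hleg : ∀ x, HEq (leg d x) (leg d' x))
    (hcell : ∀ {x y : El W} (p : x ⟶ y), HEq (cell d p) (cell d' p)) :
    IsLaxConicalLimit d ↔ IsLaxConicalLimit d' := by
  subst h
  have hl := fun x => eq_of_heq (hleg x)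
  rw [LaxCone.ext_of hl fun {x y} p =>
    (conj_eqToHom_iff_heq _ _ (congrArg (· ≫ K.map p) (hl x)) (hl y)).2 (hcell p)]

end Congr

variable {A : Type u₁} [Bicategory.{w₁, v₁} A] [Strict A]
  {C : Type u₂} [Bicategory.{w, v} C] [Strict C] {D : Type u₃} [Bicategory.{w, v} D] [Strict D]

/-! ### The isomorphism of cone categories and its compatibility with `G`. -/

namespace Cylinder

variable (W : StrictPseudofunctor A Cat.{w, v}) (F : StrictPseudofunctor A C)

/-- Cylinders over `F` and cartesian-marked lax cones over `F ∘ π` are isomorphic, 2-naturally in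
the vertex. -/
def coneIso : ConeIso (fun _ _ _ => True) W.toLax F El.IsCart (deltaOne (El W)).toLax
    ((El.proj W).comp F) where
  hom U := laxConeFunctor W F U
  inv U := LaxCone.cylinderFunctor W F U
  hom_inv _ := CategoryTheory.Functor.ext toCylinder_toLaxCone
    fun _ _ _ => eq_conj_eqToHom _ _ fun _ _ => HEq.rfl
  inv_hom _ := CategoryTheory.Functor.ext toLaxCone_toCylinder
    fun _ _ _ => LaxCone.eq_conj_eqToHom _ _ fun _ => HEq.rfl
  natural u := CategoryTheory.Functor.ext (restrict_toLaxCone u)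
    fun _ _ _ => LaxCone.eq_conj_eqToHom _ _ fun _ => HEq.rfl
  natural₂ _ _ := LaxCone.eq_conj_eqToHom _ _ fun _ => HEq.rfl

variable {W F}

/-- A cylinder is a weighted 2-limit if and only if the associated lax cone is a limit. -/
theorem isWeightedLimit_iff {L : C} (c : Cylinder W F L) :
    IsWeightedLimit c ↔ IsLaxConicalLimit c.toLaxCone :=
  (coneIso W F).isUniversal_iff c

/-- The two cones have the same legs and cells, but one lies over `(F ∘ π)` followed by `G` and the
other over `π` followed by `G ∘ F`. These diagrams agree by `rfl` only as prelax functors, hence the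
passage through heterogeneous equality. -/
lemma isLaxConicalLimit_image_iff (G : StrictPseudofunctor C D) {L : C} (c : Cylinder W F L) :
    IsLaxConicalLimit (Cone.image G c.toLaxCone) ↔
      IsLaxConicalLimit (Cylinder.toLaxCone (Cone.image G c)) := by
  refine LaxCone.isLaxConicalLimit_congr (strictPseudofunctor_ext
    (K := ((El.proj W).comp F).comp G) (K' := (El.proj W).comp (F.comp G)) rfl) _ _
    (fun _ => HEq.rfl) (fun {_ _} p => heq_of_eq ?_)
  exact (comp_naturality_app c.toLaxCone.obj (homImage ((El.proj W).comp F) G L) p pt).trans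
    (laxMap_comp_right c.obj (homImage F G L) p.base p.fiber).symm

/-- The image of a cylinder is a weighted 2-limit if and only if the image of the associated lax
cone is a limit. -/
theorem isWeightedLimit_image_iff (G : StrictPseudofunctor C D) {L : C} (c : Cylinder W F L) :
    IsWeightedLimit (Cone.image G c) ↔ IsLaxConicalLimit (Cone.image G c.toLaxCone) :=
  (isWeightedLimit_iff (Cone.image G c)).trans (isLaxConicalLimit_image_iff G c).symm

end Cylinder
end TwoLim

theorem mainTheorem12 {A : Type u₁} [Bicategory.{w₁, v₁} A] [Strict A]
    {C : Type u₂} [Bicategory.{w, v} C] [Strict C]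
    {D : Type u₃} [Bicategory.{w, v} D] [Strict D]
    (W : StrictPseudofunctor A Cat.{w, v}) (F : StrictPseudofunctor A C)
    (G : StrictPseudofunctor C D) :
    -- the associated cone of a universal cylinder is universal, and conversely
    (∀ (L : C) (c : TwoLim.Cylinder W F L),
      TwoLim.IsWeightedLimit c ↔ TwoLim.IsLaxConicalLimit c.toLaxCone) ∧
    -- `G` preserves a given weighted 2-limit iff it preserves the associated limit
    (∀ (L : C) (c : TwoLim.Cylinder W F L), TwoLim.IsWeightedLimit c →
      (TwoLim.IsWeightedLimit (TwoLim.Cone.image G c) ↔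
        TwoLim.IsLaxConicalLimit (TwoLim.Cone.image G c.toLaxCone))) ∧
    -- `G` reflects universality of a given cylinder iff it reflects that of the associated cone
    (∀ (L : C) (c : TwoLim.Cylinder W F L),
      (TwoLim.IsWeightedLimit (TwoLim.Cone.image G c) → TwoLim.IsWeightedLimit c) ↔
        (TwoLim.IsLaxConicalLimit (TwoLim.Cone.image G c.toLaxCone) →
          TwoLim.IsLaxConicalLimit c.toLaxCone)) ∧
    -- the same for all limits of the given weight and diagram
    (TwoLim.PreservesWeightedLimit W F G ↔
      TwoLim.PreservesLaxConicalLimit ((TwoLim.El.proj W).comp F) G) ∧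
    (TwoLim.ReflectsWeightedLimit W F G ↔
      TwoLim.ReflectsLaxConicalLimit ((TwoLim.El.proj W).comp F) G) := by
  have h := fun (L : C) (c : TwoLim.Cylinder W F L) => c.isWeightedLimit_iff
  have hG := fun (L : C) (c : TwoLim.Cylinder W F L) => c.isWeightedLimit_image_iff G
  refine ⟨h, fun L c _ => hG L c, fun L c => by rw [h, hG], ⟨fun H L d hd => ?_, fun H L c hc => ?_⟩,
    ⟨fun H L d hd => ?_, fun H L c hc => ?_⟩⟩
  -- An arbitrary lax cone is replaced by the one associated with its cylinder, to which the
  -- equivalences for cylinders apply.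
  · rw [← TwoLim.Cylinder.toLaxCone_toCylinder d] at hd ⊢
    exact (hG _ _).1 (H _ ((h _ _).2 hd))
  · exact (hG _ _).2 (H _ ((h _ _).1 hc))
  · rw [← TwoLim.Cylinder.toLaxCone_toCylinder d] at hd ⊢
    exact (h _ _).1 (H _ ((hG _ _).2 hd))
  · exact (h _ _).2 (H _ ((hG _ _).1 hc))
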